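/- Let $m,n$ be natural numbers, let $X\in\mathbb R^{m\times n}$, let $\Omega\subseteq\{1,\dots,m\}\times\{1,\dots,n\}$ be a set of index pairs, and let $\lambda\ge 0$. For $Y\in\mathbb R^{m\times n}$ let $P_\Omega(Y)$ be the matrix with entries $Y_{ij}$ for $(i,j)\in\Omega$ and $0$ otherwise, and let $P_\Omega^\perp(Y)=Y-P_\Omega(Y)$. Let $\|\cdot\|_F$ be the Frobenius norm and $\|\cdot\|_*$ the nuclear norm (the sum of the singular values). For a matrix $W$ with singular value decomposition $W=U\,\mathrm{diag}(d_1,\dots,d_r)\,V^{T}$, where $r=\operatorname{rank}W$, let $\mathbf S_\lambda(W)=U\,\mathrm{diag}\big((d_1-\lambda)_+,\dots,(d_r-\lambda)_+\big)V^{T}$ with $t_+=\max(t,0)$. Define the Soft-Impute iterates by $$Z^0=0,\qquad Z^{k+1}=\mathbf S_\lambda\big(P_\Omega(X)+P_\Omega^\perp(Z^k)\big)\quad(k\ge 0).$$ **Theorem (convergence of Soft-Impute).** For every $k\ge 0$, the matrix $Z^{k+1}$ is the unique minimizer over $Z\in\mathbb R^{m\times n}$ of $$Q_\lambda(Z\mid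 Z^k)=\tfrac12\big\|P_\Omega(X)+P_\Omega^\perp(Z^k)-Z\big\|_F^2+\lambda\|Z\|_* .$$ Moreover, the sequence $(Z^k)_{k\ge 0}$ converges to a matrix $Z^\infty\in\mathbb R^{m\times n}$, and $Z^\infty$ minimizes $$f_\lambda(Z)=\tfrac12\|P_\Omega(Z)-P_\Omega(X)\|_F^2+\lambda\|Z\|_*$$ over all $Z\in\mathbb R^{m\times n}$. -/

import Mathlib

namespace SoftImpute

open Matrix

noncomputable section

/-- `P_Ω(Y)`: keep the entries in `Ω`, replace all others by zero. -/
def proj {m n : ℕ} (Ω : Finset (Fin m × Fin n)) (Y : Matrix (Fin m) (Fin n) ℝ) :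
    Matrix (Fin m) (Fin n) ℝ :=
  Matrix.of fun i j => if (i, j) ∈ Ω then Y i j else 0

/-- The complementary projection, defined by `P_Ω^⊥(Y) + P_Ω(Y) = Y`. -/
def projPerp {m n : ℕ} (Ω : Finset (Fin m × Fin n)) (Y : Matrix (Fin m) (Fin n) ℝ) :
    Matrix (Fin m) (Fin n) ℝ :=
  Y - proj Ω Y

/-- The singular values of `W`, in decreasing order and with multiplicity (trailing zeros
included), indexed by the columns. -/
def sval {m n : ℕ} (W : Matrix (Fin m) (Fin n) ℝ) (i : Fin n) : ℝ :=
  W.toEuclideanLin.singularValues i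

/-- An orthonormal basis of right singular vectors of `W`: eigenvectors of `Wᵀ W`, ordered as the
singular values are. -/
def rightVec {m n : ℕ} (W : Matrix (Fin m) (Fin n) ℝ) :
    OrthonormalBasis (Fin n) ℝ (EuclideanSpace ℝ (Fin n)) :=
  W.toEuclideanLin.isSymmetric_adjoint_comp_self.eigenvectorBasis finrank_euclideanSpace_fin

/-- The left singular vector `u_i = d_i⁻¹ W v_i` (zero if `d_i = 0`). -/
def leftVec {m n : ℕ} (W : Matrix (Fin m) (Fin n) ℝ) (i : Fin n) : EuclideanSpace ℝ (Fin m) :=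
  (sval W i)⁻¹ • W.toEuclideanLin (rightVec W i)

/-- The nuclear norm: the sum of the singular values. -/
def nuclearNorm {m n : ℕ} (W : Matrix (Fin m) (Fin n) ℝ) : ℝ :=
  ∑ i, sval W i

/-- `S_lam(W) = ∑ (d_i - lam)_+ u_i v_iᵀ`, where `W = ∑ d_i u_i v_iᵀ` is a singular value
decomposition. -/
def softThreshold {m n : ℕ} (lam : ℝ) (W : Matrix (Fin m) (Fin n) ℝ) :
    Matrix (Fin m) (Fin n) ℝ :=
  ∑ i, max (sval W i - lam) 0 • vecMulVec (leftVec W i) (rightVec W i)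

section Objective

attribute [local instance] Matrix.frobeniusNormedAddCommGroup

/-- `f_lam(Z) = ½ ‖P_Ω(Z) - P_Ω(X)‖_F² + lam ‖Z‖_*`. -/
def objective {m n : ℕ} (Ω : Finset (Fin m × Fin n)) (X : Matrix (Fin m) (Fin n) ℝ) (lam : ℝ)
    (Z : Matrix (Fin m) (Fin n) ℝ) : ℝ :=
  1 / 2 * ‖proj Ω Z - proj Ω X‖ ^ 2 + lam * nuclearNorm Z

/-- `Q_lam(Z | Z') = ½ ‖P_Ω(X) + P_Ω^⊥(Z') - Z‖_F² + lam ‖Z‖_*`. -/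
def surrogate {m n : ℕ} (Ω : Finset (Fin m × Fin n)) (X : Matrix (Fin m) (Fin n) ℝ) (lam : ℝ)
    (Z' Z : Matrix (Fin m) (Fin n) ℝ) : ℝ :=
  1 / 2 * ‖proj Ω X + projPerp Ω Z' - Z‖ ^ 2 + lam * nuclearNorm Z

end Objective

/-- The iterates: `Z⁰ = 0` and `Z^{k+1} = S_lam(P_Ω(X) + P_Ω^⊥(Z^k))`. -/
def iterate {m n : ℕ} (Ω : Finset (Fin m × Fin n)) (X : Matrix (Fin m) (Fin n) ℝ) (lam : ℝ) :
    ℕ → Matrix (Fin m) (Fin n) ℝ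
  | 0 => 0
  | k + 1 => softThreshold lam (proj Ω X + projPerp Ω (iterate Ω X lam k))

/-- The right singular vectors are eigenvectors of `Wᵀ W`. -/
theorem gram_rightVec {m n : ℕ} (W : Matrix (Fin m) (Fin n) ℝ) (i : Fin n) :
    Wᵀ *ᵥ (W *ᵥ (rightVec W i).ofLp) = (sval W i) ^ 2 • (rightVec W i).ofLp := by
  have h := W.toEuclideanLin.isSymmetric_adjoint_comp_self.apply_eigenvectorBasis
    finrank_euclideanSpace_fin i
  rw [← LinearMap.sq_singularValues_fin, LinearMap.comp_apply] at h
  have h2 := congrArg WithLp.ofLp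
    ((LinearMap.congr_fun (Matrix.toEuclideanLin_conjTranspose_eq_adjoint W) _).trans h)
  simpa [rightVec, sval, Matrix.toEuclideanLin, Matrix.conjTranspose_eq_transpose_of_trivial]
    using h2

/-- Expansion of a matrix in the basis of right singular vectors of `W`. -/
theorem matrix_eq_sum {m n : ℕ} (W M : Matrix (Fin m) (Fin n) ℝ) :
    M = ∑ i, vecMulVec (M *ᵥ (rightVec W i).ofLp) (rightVec W i).ofLp := by
  apply Matrix.toEuclideanLin.injective
  refine (rightVec W).toBasis.ext fun k => ?_
  rw [OrthonormalBasis.coe_toBasis]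
  apply WithLp.ofLp_injective
  have ho : ∀ i, (rightVec W i).ofLp ⬝ᵥ (rightVec W k).ofLp = if k = i then 1 else 0 := by
    intro i
    have h := orthonormal_iff_ite.1 (rightVec W).orthonormal k i
    simpa [EuclideanSpace.inner_eq_star_dotProduct] using h
  simp [Matrix.toEuclideanLin, Matrix.vecMulVec_mulVec, ho]

/-- The definition of `softThreshold` does not depend on the decomposition: it is
`U diag((d_1 - lam)_+, …, (d_r - lam)_+) Vᵀ` for every (compact) singular value decomposition
`W = U diag(d_1, …, d_r) Vᵀ`. -/
theorem softThreshold_eq {m n r : ℕ} (lam : ℝ) (W : Matrix (Fin m) (Fin n) ℝ)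
    (U : Matrix (Fin m) (Fin r) ℝ) (d : Fin r → ℝ) (V : Matrix (Fin n) (Fin r) ℝ)
    (hU : Uᵀ * U = 1) (hV : Vᵀ * V = 1) (hd : ∀ j, 0 < d j) (hW : W = U * diagonal d * Vᵀ) :
    softThreshold lam W = U * diagonal (fun j => max (d j - lam) 0) * Vᵀ := by
  rw [matrix_eq_sum W (U * diagonal (fun j => max (d j - lam) 0) * Vᵀ), softThreshold]
  refine Finset.sum_congr rfl fun i _ => ?_
  have hs : 0 ≤ sval W i := LinearMap.singularValues_nonneg _ _
  have hg := congrArg (fun w => Vᵀ *ᵥ w) (gram_rightVec W i)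
  have hWt : Wᵀ = V * (diagonal d * Uᵀ) := by
    rw [hW]; simp [Matrix.transpose_mul]
  have hmat : Vᵀ * (Wᵀ * W) = diagonal d * (diagonal d * Vᵀ) := by
    rw [hWt]
    nth_rewrite 1 [hW]
    calc Vᵀ * (V * (diagonal d * Uᵀ) * (U * diagonal d * Vᵀ))
        = (Vᵀ * V) * diagonal d * (Uᵀ * U) * (diagonal d * Vᵀ) := by
          simp only [Matrix.mul_assoc]
      _ = _ := by rw [hU, hV]; simp
  simp only [Matrix.mulVec_mulVec, Matrix.mulVec_smul] at hg
  rw [hmat, ← Matrix.mulVec_mulVec, ← Matrix.mulVec_mulVec] at hg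
  have hL : (leftVec W i).ofLp = (sval W i)⁻¹ • (W *ᵥ (rightVec W i).ofLp) := by
    simp [leftVec, Matrix.toEuclideanLin]
  have hWv : W *ᵥ (rightVec W i).ofLp =
      U *ᵥ (diagonal d *ᵥ (Vᵀ *ᵥ (rightVec W i).ofLp)) := by
    conv_lhs => lhs; rw [hW]
    simp only [Matrix.mulVec_mulVec, Matrix.mul_assoc]
  rw [hL, hWv, ← Matrix.smul_vecMulVec, ← Matrix.mulVec_mulVec, ← Matrix.mulVec_mulVec, smul_smul,
    ← Matrix.mulVec_smul]
  congr 2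
  funext j
  have hj := congrFun hg j
  simp only [Matrix.mulVec_diagonal, Pi.smul_apply, smul_eq_mul] at hj ⊢
  generalize (Vᵀ *ᵥ (rightVec W i).ofLp) j = a at hj ⊢
  rcases eq_or_ne a 0 with rfl | ha
  · simp
  · have h1 : d j ^ 2 = sval W i ^ 2 := by
      apply mul_right_cancel₀ ha
      linarith
    have h2 : d j = sval W i := by
      rwa [sq_eq_sq₀ (hd j).le hs] at h1
    have h3 := (hd j).ne'
    rw [← h2]
    field_simp

end

end SoftImpute

namespace SoftImpute

open Matrix Filter Topology

noncomputable section

variable {m n : ℕ}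

/-! Everything rests on one inequality, `softThreshold_subgradient`: `W - S_lam(W)` is a subgradient
of `lam ‖·‖_*` at `S_lam(W)`. It follows from the duality of nuclear and spectral norms, since the
residual has singular coefficients `min (d_i) lam`.

It yields three facts. The surrogate exceeds its value at `S_lam(W)` by at least half the squared
distance, so its minimizer is unique. `S_lam` is firmly nonexpansive, hence so is one step
nonexpansive. A fixed point of the step satisfies the first-order optimality condition for the
convex objective, hence minimizes it.

For convergence, majorization makes the objective decrease by at least half the squared step length,
so consecutive iterates become arbitrarily close. The iterates are bounded, so a subsequence
converges, and its limit is a fixed point. Distances to a fixed point never increase, so the whole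
sequence converges to it. -/

/-- The Frobenius inner product. -/
def frob (A B : Matrix (Fin m) (Fin n) ℝ) : ℝ := (Aᵀ * B).trace

theorem frob_sub_left (A B C : Matrix (Fin m) (Fin n) ℝ) :
    frob (A - B) C = frob A C - frob B C := by
  simp [frob, Matrix.sub_mul]

theorem frob_sub_right (A B C : Matrix (Fin m) (Fin n) ℝ) :
    frob A (B - C) = frob A B - frob A C := by
  simp [frob, Matrix.mul_sub]

theorem frob_comm (A B : Matrix (Fin m) (Fin n) ℝ) : frob A B = frob B A := by
  rw [frob, ← Matrix.trace_transpose]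
  simp [frob, Matrix.transpose_mul]

theorem frob_eq_sum (A B : Matrix (Fin m) (Fin n) ℝ) :
    frob A B = ∑ i, ∑ j, A i j * B i j := by
  rw [Finset.sum_comm]
  simp [frob, Matrix.trace, Matrix.mul_apply]

theorem frob_self_nonneg (A : Matrix (Fin m) (Fin n) ℝ) : 0 ≤ frob A A := by
  rw [frob_eq_sum]
  exact Finset.sum_nonneg fun i _ => Finset.sum_nonneg fun j _ => mul_self_nonneg _

section FrobeniusNorm

attribute [local instance] Matrix.frobeniusNormedAddCommGroup

theorem frobenius_norm_sq (A : Matrix (Fin m) (Fin n) ℝ) : ‖A‖ ^ 2 = frob A A := by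
  rw [Matrix.frobenius_norm_def, frob_eq_sum, ← Real.sqrt_eq_rpow, Real.sq_sqrt]
  · simp [sq]
  · positivity

end FrobeniusNorm

theorem frob_self_pos {A : Matrix (Fin m) (Fin n) ℝ} (h : A ≠ 0) : 0 < frob A A := by
  refine lt_of_le_of_ne (frob_self_nonneg A) fun h0 => h ?_
  rw [frob_eq_sum] at h0
  ext i j
  have h1 := (Finset.sum_eq_zero_iff_of_nonneg fun i _ =>
    Finset.sum_nonneg fun j _ => mul_self_nonneg (A i j)).1 h0.symm i (Finset.mem_univ i)
  have h2 := (Finset.sum_eq_zero_iff_of_nonneg fun j _ => mul_self_nonneg (A i j)).1 h1 j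
    (Finset.mem_univ j)
  simpa using h2

/-! ### Singular vectors -/

theorem sval_nonneg (W : Matrix (Fin m) (Fin n) ℝ) (i : Fin n) : 0 ≤ sval W i :=
  LinearMap.singularValues_nonneg _ _

theorem nuclearNorm_nonneg (W : Matrix (Fin m) (Fin n) ℝ) : 0 ≤ nuclearNorm W :=
  Finset.sum_nonneg fun i _ => sval_nonneg W i

theorem rightVec_dotProduct (W : Matrix (Fin m) (Fin n) ℝ) (i j : Fin n) :
    (rightVec W i).ofLp ⬝ᵥ (rightVec W j).ofLp = if i = j then 1 else 0 := by
  have h := orthonormal_iff_ite.1 (rightVec W).orthonormal j i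
  simpa [EuclideanSpace.inner_eq_star_dotProduct, eq_comm] using h

theorem mulVec_dotProduct_mulVec_rightVec (W : Matrix (Fin m) (Fin n) ℝ) (i j : Fin n) :
    (W *ᵥ (rightVec W i).ofLp) ⬝ᵥ (W *ᵥ (rightVec W j).ofLp) =
      if i = j then sval W i ^ 2 else 0 := by
  rw [dotProduct_comm, Matrix.dotProduct_mulVec, ← Matrix.mulVec_transpose, ← dotProduct_comm,
    dotProduct_comm, dotProduct_comm, gram_rightVec]
  split_ifs with h
  · subst h; simp [rightVec_dotProduct]
  · simp [rightVec_dotProduct, h]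

theorem leftVec_ofLp (W : Matrix (Fin m) (Fin n) ℝ) (i : Fin n) :
    (leftVec W i).ofLp = (sval W i)⁻¹ • (W *ᵥ (rightVec W i).ofLp) := by
  simp [leftVec, Matrix.toEuclideanLin]

theorem mulVec_rightVec (W : Matrix (Fin m) (Fin n) ℝ) (i : Fin n) :
    W *ᵥ (rightVec W i).ofLp = sval W i • (leftVec W i).ofLp := by
  rw [leftVec_ofLp, smul_smul]
  rcases eq_or_ne (sval W i) 0 with h | h
  -- Here `leftVec` is zero by the convention `0⁻¹ = 0`, and `W v_i` vanishes because its squared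
  -- length is `d_i² = 0`.
  · have h1 := mulVec_dotProduct_mulVec_rightVec W i i
    rw [if_pos rfl, h, zero_pow two_ne_zero, dotProduct_self_eq_zero] at h1
    simp [h1]
  · simp [h]

theorem leftVec_dotProduct_of_ne (W : Matrix (Fin m) (Fin n) ℝ) {i j : Fin n} (h : i ≠ j) :
    (leftVec W i).ofLp ⬝ᵥ (leftVec W j).ofLp = 0 := by
  simp [leftVec_ofLp, mulVec_dotProduct_mulVec_rightVec, h]

theorem leftVec_dotProduct_self (W : Matrix (Fin m) (Fin n) ℝ) (i : Fin n) :
    (leftVec W i).ofLp ⬝ᵥ (leftVec W i).ofLp = if sval W i = 0 then 0 else 1 := by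
  simp only [leftVec_ofLp, smul_dotProduct, dotProduct_smul, mulVec_dotProduct_mulVec_rightVec,
    if_true, smul_eq_mul]
  split_ifs with h
  · simp [h]
  · field_simp

/-- The trace may be computed in any orthonormal basis; `W` only supplies the basis and need not be
related to `A` or `B`. -/
theorem frob_eq_sum_rightVec (W A B : Matrix (Fin m) (Fin n) ℝ) :
    frob A B = ∑ i, (A *ᵥ (rightVec W i).ofLp) ⬝ᵥ (B *ᵥ (rightVec W i).ofLp) := by
  conv_lhs => rw [matrix_eq_sum W B]
  rw [frob, Matrix.mul_sum, Matrix.trace_sum]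
  refine Finset.sum_congr rfl fun i _ => ?_
  rw [Matrix.mul_vecMulVec, Matrix.trace_vecMulVec, Matrix.mulVec_transpose,
    ← Matrix.dotProduct_mulVec, dotProduct_comm]

/-- `∑ c_i u_i v_iᵀ`, for the singular vectors `u_i`, `v_i` of `W`. -/
def spectral (W : Matrix (Fin m) (Fin n) ℝ) (c : Fin n → ℝ) : Matrix (Fin m) (Fin n) ℝ :=
  ∑ i, c i • vecMulVec (leftVec W i).ofLp (rightVec W i).ofLp

theorem softThreshold_eq_spectral (lam : ℝ) (W : Matrix (Fin m) (Fin n) ℝ) :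
    softThreshold lam W = spectral W fun i => max (sval W i - lam) 0 := rfl

theorem spectral_sval (W : Matrix (Fin m) (Fin n) ℝ) : spectral W (sval W) = W := by
  conv_rhs => rw [matrix_eq_sum W W]
  simp [spectral, mulVec_rightVec, Matrix.smul_vecMulVec]

theorem spectral_sub (W : Matrix (Fin m) (Fin n) ℝ) (c d : Fin n → ℝ) :
    spectral W c - spectral W d = spectral W fun i => c i - d i := by
  simp [spectral, sub_smul, Finset.sum_sub_distrib]

theorem spectral_mulVec (W : Matrix (Fin m) (Fin n) ℝ) (c : Fin n → ℝ) (q : Fin n → ℝ) :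
    spectral W c *ᵥ q =
      ∑ i, (c i * ((rightVec W i).ofLp ⬝ᵥ q)) • (leftVec W i).ofLp := by
  simp [spectral, Matrix.sum_mulVec, Matrix.smul_mulVec, Matrix.vecMulVec_mulVec, smul_smul]

theorem spectral_mulVec_rightVec (W : Matrix (Fin m) (Fin n) ℝ) (c : Fin n → ℝ) (k : Fin n) :
    spectral W c *ᵥ (rightVec W k).ofLp = c k • (leftVec W k).ofLp := by
  simp [spectral_mulVec, rightVec_dotProduct]

theorem sum_sq_rightVec_dotProduct (W : Matrix (Fin m) (Fin n) ℝ) (q : Fin n → ℝ) :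
    ∑ i, ((rightVec W i).ofLp ⬝ᵥ q) ^ 2 = q ⬝ᵥ q := by
  have h := (rightVec W).sum_sq_norm_inner_right (WithLp.toLp 2 q)
  rw [EuclideanSpace.real_norm_sq_eq] at h
  simpa [EuclideanSpace.inner_eq_star_dotProduct, dotProduct_comm, dotProduct, sq, mul_comm]
    using h

theorem frob_spectral (W : Matrix (Fin m) (Fin n) ℝ) (c d : Fin n → ℝ) :
    frob (spectral W c) (spectral W d) = ∑ i, if sval W i = 0 then 0 else c i * d i := by
  rw [frob_eq_sum_rightVec W]
  refine Finset.sum_congr rfl fun i _ => ?_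
  simp [spectral_mulVec_rightVec, leftVec_dotProduct_self, mul_comm]

/-- A spectral norm bound: the left vectors are orthogonal of length at most one, and Parseval
handles the right ones. -/
theorem spectral_mulVec_dotProduct_self_le (W : Matrix (Fin m) (Fin n) ℝ) {c : Fin n → ℝ} {l : ℝ}
    (h0 : ∀ i, 0 ≤ c i) (h1 : ∀ i, c i ≤ l) (q : Fin n → ℝ) :
    (spectral W c *ᵥ q) ⬝ᵥ (spectral W c *ᵥ q) ≤ l ^ 2 * (q ⬝ᵥ q) := by
  have key : (spectral W c *ᵥ q) ⬝ᵥ (spectral W c *ᵥ q) =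
      ∑ i, (c i * ((rightVec W i).ofLp ⬝ᵥ q)) ^ 2 *
        ((leftVec W i).ofLp ⬝ᵥ (leftVec W i).ofLp) := by
    rw [spectral_mulVec, sum_dotProduct]
    refine Finset.sum_congr rfl fun i _ => ?_
    rw [dotProduct_sum, Finset.sum_eq_single i]
    · simp only [smul_dotProduct, dotProduct_smul, smul_eq_mul]
      ring
    · intro j _ hj
      simp [leftVec_dotProduct_of_ne W hj.symm]
    · simp
  rw [key, ← sum_sq_rightVec_dotProduct W q, Finset.mul_sum]
  refine Finset.sum_le_sum fun i _ => ?_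
  have hu : (leftVec W i).ofLp ⬝ᵥ (leftVec W i).ofLp ≤ 1 := by
    rw [leftVec_dotProduct_self]
    split_ifs <;> norm_num
  calc _ ≤ (c i * ((rightVec W i).ofLp ⬝ᵥ q)) ^ 2 * 1 := by gcongr
    _ = c i ^ 2 * ((rightVec W i).ofLp ⬝ᵥ q) ^ 2 := by ring
    _ ≤ _ := by
      have := h0 i
      have := h1 i
      gcongr

/-! ### Duality of the nuclear and spectral norms. -/

theorem dotProduct_le_mul {ι : Type*} [Fintype ι] {x y : ι → ℝ} {a b : ℝ} (ha : 0 ≤ a)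
    (hb : 0 ≤ b) (hx : x ⬝ᵥ x ≤ a ^ 2) (hy : y ⬝ᵥ y ≤ b ^ 2) : x ⬝ᵥ y ≤ a * b := by
  refine le_of_sq_le_sq ?_ (mul_nonneg ha hb)
  calc (x ⬝ᵥ y) ^ 2 ≤ (x ⬝ᵥ x) * (y ⬝ᵥ y) := by
        simpa [dotProduct, sq] using Finset.sum_mul_sq_le_sq_mul_sq Finset.univ x y
    _ ≤ a ^ 2 * b ^ 2 := by
        have : 0 ≤ y ⬝ᵥ y := Finset.sum_nonneg fun i _ => mul_self_nonneg _
        gcongr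
    _ = _ := by ring

/-- The nuclear norm dominates the pairing with matrices of spectral norm at most one. -/
theorem frob_le_nuclearNorm {G : Matrix (Fin m) (Fin n) ℝ} {l : ℝ} (hl : 0 ≤ l)
    (hG : ∀ q, (G *ᵥ q) ⬝ᵥ (G *ᵥ q) ≤ l ^ 2 * (q ⬝ᵥ q)) (Y : Matrix (Fin m) (Fin n) ℝ) :
    frob G Y ≤ l * nuclearNorm Y := by
  -- In the right singular basis of `Y`, Cauchy–Schwarz applies termwise with `|G v_i| ≤ l` and `|Y
  -- v_i| = d_i`.
  rw [frob_eq_sum_rightVec Y, nuclearNorm, Finset.mul_sum]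
  refine Finset.sum_le_sum fun i _ => dotProduct_le_mul hl (sval_nonneg Y i) ?_ ?_
  · simpa [rightVec_dotProduct] using hG (rightVec Y i).ofLp
  · simp [mulVec_dotProduct_mulVec_rightVec]

/-- The polar factor `∑ u_i v_iᵀ` attains the dual bound. -/
theorem nuclearNorm_eq_frob (Y : Matrix (Fin m) (Fin n) ℝ) :
    nuclearNorm Y = frob Y (spectral Y fun _ => 1) := by
  conv_rhs => arg 1; rw [← spectral_sval Y]
  rw [frob_spectral, nuclearNorm]
  refine Finset.sum_congr rfl fun i _ => ?_
  split_ifs with h <;> simp [h]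

/-- Pairing with the polar factor of `spectral W c` avoids identifying the singular values of that
matrix. Equality can fail, since `u_i = 0` when `d_i = 0`. -/
theorem nuclearNorm_spectral_le (W : Matrix (Fin m) (Fin n) ℝ) {c : Fin n → ℝ}
    (hc : ∀ i, 0 ≤ c i) : nuclearNorm (spectral W c) ≤ ∑ i, c i := by
  rw [nuclearNorm_eq_frob, frob_eq_sum_rightVec W]
  refine Finset.sum_le_sum fun i _ => ?_
  rw [← mul_one (c i)]
  refine dotProduct_le_mul (hc i) zero_le_one ?_ ?_
  · rw [spectral_mulVec_rightVec, smul_dotProduct, dotProduct_smul,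
      leftVec_dotProduct_self]
    split_ifs
    · simpa using sq_nonneg (c i)
    · simp [sq]
  · have h := spectral_mulVec_dotProduct_self_le (spectral W c) (c := fun _ => 1) (l := 1)
      (fun _ => zero_le_one) (fun _ => le_rfl) (rightVec W i).ofLp
    simpa [rightVec_dotProduct] using h

theorem frob_self_le_nuclearNorm_sq (W : Matrix (Fin m) (Fin n) ℝ) :
    frob W W ≤ nuclearNorm W ^ 2 := by
  rw [frob_eq_sum_rightVec W]
  simp only [mulVec_dotProduct_mulVec_rightVec, if_true]
  exact Finset.sum_sq_le_sq_sum_of_nonneg fun i _ => sval_nonneg W i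

/-! ### Soft-thresholding as a proximal map. -/

/-- `W - S_lam(W)` is a subgradient of `lam ‖·‖_*` at `S_lam(W)`. -/
theorem softThreshold_subgradient {lam : ℝ} (hlam : 0 ≤ lam) (W Y : Matrix (Fin m) (Fin n) ℝ) :
    frob (W - softThreshold lam W) (Y - softThreshold lam W) +
      lam * nuclearNorm (softThreshold lam W) ≤ lam * nuclearNorm Y := by
  have hG : W - softThreshold lam W =
      spectral W fun i => sval W i - max (sval W i - lam) 0 := by
    conv_lhs => arg 1; rw [← spectral_sval W]
    rw [softThreshold_eq_spectral, spectral_sub]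
  have h1 : frob (W - softThreshold lam W) Y ≤ lam * nuclearNorm Y := by
    rw [hG]
    refine frob_le_nuclearNorm hlam (spectral_mulVec_dotProduct_self_le W (fun i => ?_)
      fun i => ?_) Y
    · have := sval_nonneg W i
      rcases max_cases (sval W i - lam) 0 with h | h <;> linarith
    · linarith [le_max_left (sval W i - lam) 0]
  -- Complementarity: wherever the thresholded coefficient is nonzero, the residual coefficient is
  -- exactly `lam`.
  have h2 : lam * nuclearNorm (softThreshold lam W) ≤
      frob (W - softThreshold lam W) (softThreshold lam W) := by
    rw [hG, softThreshold_eq_spectral, frob_spectral]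
    refine (mul_le_mul_of_nonneg_left
      (nuclearNorm_spectral_le W fun i => le_max_right _ _) hlam).trans ?_
    rw [Finset.mul_sum]
    refine Finset.sum_le_sum fun i _ => ?_
    split_ifs with h
    · simp [h, hlam]
    · rcases max_cases (sval W i - lam) 0 with h | h <;> simp [h.1]
  rw [frob_sub_right]
  linarith

/-- Monotonicity of the subdifferential: add the subgradient inequalities at the two points. -/
theorem softThreshold_firmly_nonexpansive {lam : ℝ} (hlam : 0 ≤ lam)
    (W W' : Matrix (Fin m) (Fin n) ℝ) :
    frob (softThreshold lam W - softThreshold lam W') (softThreshold lam W - softThreshold lam W')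
      ≤ frob (W - W') (softThreshold lam W - softThreshold lam W') := by
  have h1 := softThreshold_subgradient hlam W (softThreshold lam W')
  have h2 := softThreshold_subgradient hlam W' (softThreshold lam W)
  simp only [frob_sub_left, frob_sub_right] at *
  linarith

theorem softThreshold_zero (W : Matrix (Fin m) (Fin n) ℝ) : softThreshold 0 W = W := by
  rw [softThreshold_eq_spectral]
  simpa [sval_nonneg] using spectral_sval W

/-! ### The Soft-Impute map -/

theorem frob_proj_left (Ω : Finset (Fin m × Fin n)) (A B : Matrix (Fin m) (Fin n) ℝ) :
    frob (proj Ω A) B = frob (proj Ω A) (proj Ω B) := by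
  simp only [frob_eq_sum, proj, Matrix.of_apply]
  refine Finset.sum_congr rfl fun i _ => Finset.sum_congr rfl fun j _ => ?_
  split_ifs <;> simp

theorem proj_sub (Ω : Finset (Fin m × Fin n)) (A B : Matrix (Fin m) (Fin n) ℝ) :
    proj Ω (A - B) = proj Ω A - proj Ω B := by
  ext i j
  by_cases h : (i, j) ∈ Ω <;> simp [proj, h]

theorem proj_proj (Ω : Finset (Fin m × Fin n)) (A : Matrix (Fin m) (Fin n) ℝ) :
    proj Ω (proj Ω A) = proj Ω A := by
  ext i j
  by_cases h : (i, j) ∈ Ω <;> simp [proj, h]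

theorem projPerp_sub (Ω : Finset (Fin m × Fin n)) (A B : Matrix (Fin m) (Fin n) ℝ) :
    projPerp Ω (A - B) = projPerp Ω A - projPerp Ω B := by
  simp only [projPerp, proj_sub]
  abel

theorem frob_projPerp_self_le (Ω : Finset (Fin m × Fin n)) (A : Matrix (Fin m) (Fin n) ℝ) :
    frob (projPerp Ω A) (projPerp Ω A) ≤ frob A A := by
  have h1 := frob_proj_left Ω A A
  have h2 := frob_self_nonneg (proj Ω A)
  have h3 := frob_comm A (proj Ω A)
  simp only [projPerp, frob_sub_left, frob_sub_right]
  linarith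

/-- One step of Soft-Impute. -/
def step (Ω : Finset (Fin m × Fin n)) (X : Matrix (Fin m) (Fin n) ℝ) (lam : ℝ)
    (Z : Matrix (Fin m) (Fin n) ℝ) : Matrix (Fin m) (Fin n) ℝ :=
  softThreshold lam (proj Ω X + projPerp Ω Z)

theorem iterate_succ (Ω : Finset (Fin m × Fin n)) (X : Matrix (Fin m) (Fin n) ℝ) (lam : ℝ)
    (k : ℕ) : iterate Ω X lam (k + 1) = step Ω X lam (iterate Ω X lam k) := rfl

theorem step_nonexpansive {lam : ℝ} (hlam : 0 ≤ lam) (Ω : Finset (Fin m × Fin n))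
    (X A B : Matrix (Fin m) (Fin n) ℝ) :
    frob (step Ω X lam A - step Ω X lam B) (step Ω X lam A - step Ω X lam B) ≤
      frob (A - B) (A - B) := by
  have h1 := softThreshold_firmly_nonexpansive hlam (proj Ω X + projPerp Ω A)
    (proj Ω X + projPerp Ω B)
  rw [add_sub_add_left_eq_sub, ← projPerp_sub] at h1
  have h2 := frob_projPerp_self_le Ω (A - B)
  change frob (step Ω X lam A - step Ω X lam B) (step Ω X lam A - step Ω X lam B) ≤
    frob _ (step Ω X lam A - step Ω X lam B) at h1
  generalize step Ω X lam A - step Ω X lam B = D at h1 ⊢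
  -- With `P = projPerp Ω (A - B)`, expanding `0 ≤ ‖P - D‖²` and using `‖D‖² ≤ ⟨D, P⟩` gives `‖D‖² ≤
  -- ‖P‖²`.
  have h3 := frob_self_nonneg (projPerp Ω (A - B) - D)
  have h4 := frob_comm D (projPerp Ω (A - B))
  rw [frob_sub_left, frob_sub_right, frob_sub_right] at h3
  linarith

/-! ### Majorization, descent and optimality of fixed points. -/

theorem objective_eq (Ω : Finset (Fin m × Fin n)) (X : Matrix (Fin m) (Fin n) ℝ) (lam : ℝ)
    (Z : Matrix (Fin m) (Fin n) ℝ) :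
    objective Ω X lam Z =
      1 / 2 * frob (proj Ω Z - proj Ω X) (proj Ω Z - proj Ω X) + lam * nuclearNorm Z := by
  rw [objective, frobenius_norm_sq]

theorem surrogate_eq (Ω : Finset (Fin m × Fin n)) (X : Matrix (Fin m) (Fin n) ℝ) (lam : ℝ)
    (Z' Z : Matrix (Fin m) (Fin n) ℝ) :
    surrogate Ω X lam Z' Z =
      1 / 2 * frob (proj Ω X + projPerp Ω Z' - Z) (proj Ω X + projPerp Ω Z' - Z) +
        lam * nuclearNorm Z := by
  rw [surrogate, frobenius_norm_sq]

theorem objective_nonneg {lam : ℝ} (hlam : 0 ≤ lam) (Ω : Finset (Fin m × Fin n))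
    (X Z : Matrix (Fin m) (Fin n) ℝ) : 0 ≤ objective Ω X lam Z := by
  rw [objective_eq]
  have h1 := frob_self_nonneg (proj Ω Z - proj Ω X)
  have h2 := mul_nonneg hlam (nuclearNorm_nonneg Z)
  linarith

/-- The surrogate grows quadratically away from its minimizer. -/
theorem surrogate_step_add_le {lam : ℝ} (hlam : 0 ≤ lam) (Ω : Finset (Fin m × Fin n))
    (X Z Y : Matrix (Fin m) (Fin n) ℝ) :
    surrogate Ω X lam Z (step Ω X lam Z) +
        1 / 2 * frob (Y - step Ω X lam Z) (Y - step Ω X lam Z) ≤ surrogate Ω X lam Z Y := by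
  rw [surrogate_eq, surrogate_eq, step]
  have h := softThreshold_subgradient hlam (proj Ω X + projPerp Ω Z) Y
  generalize proj Ω X + projPerp Ω Z = W at *
  generalize softThreshold lam W = S at *
  have h1 := frob_comm S W
  have h2 := frob_comm Y W
  have h3 := frob_comm Y S
  simp only [frob_sub_left, frob_sub_right] at *
  linarith

theorem surrogate_self (Ω : Finset (Fin m × Fin n)) (X : Matrix (Fin m) (Fin n) ℝ) (lam : ℝ)
    (Z : Matrix (Fin m) (Fin n) ℝ) : surrogate Ω X lam Z Z = objective Ω X lam Z := by
  rw [surrogate_eq, objective_eq]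
  have h : proj Ω X + projPerp Ω Z - Z = -(proj Ω Z - proj Ω X) := by
    rw [projPerp]; abel
  rw [h]
  simp only [frob, Matrix.transpose_neg, Matrix.neg_mul, Matrix.mul_neg, neg_neg]

/-- The surrogate majorizes the objective. -/
theorem objective_le_surrogate (Ω : Finset (Fin m × Fin n)) (X : Matrix (Fin m) (Fin n) ℝ)
    (lam : ℝ) (Z' Z : Matrix (Fin m) (Fin n) ℝ) :
    objective Ω X lam Z ≤ surrogate Ω X lam Z' Z := by
  rw [surrogate_eq, objective_eq]
  gcongr
  simp only [frob_eq_sum]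
  refine Finset.sum_le_sum fun i _ => Finset.sum_le_sum fun j _ => ?_
  -- On `Ω` the two residuals agree up to sign; off `Ω` that of the objective is zero.
  by_cases h : (i, j) ∈ Ω
  · simp only [proj, projPerp, Matrix.sub_apply, Matrix.add_apply, Matrix.of_apply, if_pos h]
    exact le_of_eq (by ring)
  · simp only [proj, projPerp, Matrix.sub_apply, Matrix.add_apply, Matrix.of_apply, if_neg h]
    simpa using mul_self_nonneg _

theorem objective_step_add_le {lam : ℝ} (hlam : 0 ≤ lam) (Ω : Finset (Fin m × Fin n))
    (X Z : Matrix (Fin m) (Fin n) ℝ) :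
    objective Ω X lam (step Ω X lam Z) +
        1 / 2 * frob (Z - step Ω X lam Z) (Z - step Ω X lam Z) ≤ objective Ω X lam Z := by
  have h1 := surrogate_step_add_le hlam Ω X Z Z
  have h2 := objective_le_surrogate Ω X lam Z (step Ω X lam Z)
  rw [surrogate_self] at h1
  linarith

/-- At a fixed point the residual is `P_Ω(X - Z)`, the negative gradient of the quadratic term, so
it being a subgradient of `lam ‖·‖_*` is the optimality condition. -/
theorem isMinOn_objective_of_step_eq {lam : ℝ} (hlam : 0 ≤ lam) (Ω : Finset (Fin m × Fin n))
    (X : Matrix (Fin m) (Fin n) ℝ) {Z : Matrix (Fin m) (Fin n) ℝ} (hZ : step Ω X lam Z = Z) :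
    IsMinOn (objective Ω X lam) Set.univ Z := by
  intro Y _
  change objective Ω X lam Z ≤ objective Ω X lam Y
  have h := softThreshold_subgradient hlam (proj Ω X + projPerp Ω Z) Y
  rw [← step, hZ] at h
  have e : proj Ω X + projPerp Ω Z - Z = proj Ω (X - Z) := by
    rw [projPerp, proj_sub]; abel
  rw [e, frob_proj_left, proj_sub, proj_sub] at h
  rw [objective_eq, objective_eq]
  have h0 := frob_self_nonneg (proj Ω Y - proj Ω Z)
  have h1 := frob_comm (proj Ω X) (proj Ω Y)
  have h2 := frob_comm (proj Ω X) (proj Ω Z)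
  have h3 := frob_comm (proj Ω Y) (proj Ω Z)
  simp only [frob_sub_left, frob_sub_right] at *
  linarith

/-! ### Boundedness and vanishing step lengths. -/

theorem iterate_succ_of_lam_zero (Ω : Finset (Fin m × Fin n)) (X : Matrix (Fin m) (Fin n) ℝ)
    (k : ℕ) : iterate Ω X 0 (k + 1) = proj Ω X := by
  have hPP : projPerp Ω (proj Ω X) = 0 := by rw [projPerp, proj_proj, sub_self]
  induction k with
  | zero =>
    rw [iterate_succ, step, softThreshold_zero]
    ext i j
    simp [iterate, projPerp, proj]
  | succ k ih => rw [iterate_succ, ih, step, softThreshold_zero, hPP, add_zero]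

theorem objective_iterate_antitone {lam : ℝ} (hlam : 0 ≤ lam) (Ω : Finset (Fin m × Fin n))
    (X : Matrix (Fin m) (Fin n) ℝ) : Antitone fun k => objective Ω X lam (iterate Ω X lam k) := by
  refine antitone_nat_of_succ_le fun k => ?_
  have h := objective_step_add_le hlam Ω X (iterate Ω X lam k)
  have h0 := frob_self_nonneg (iterate Ω X lam k - step Ω X lam (iterate Ω X lam k))
  rw [iterate_succ]
  linarith

/-- For `lam > 0` the decreasing objective bounds the nuclear norm. For `lam = 0` it controls only
the entries in `Ω`, but then the iteration is constant after one step. -/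
theorem exists_frob_iterate_le {lam : ℝ} (hlam : 0 ≤ lam) (Ω : Finset (Fin m × Fin n))
    (X : Matrix (Fin m) (Fin n) ℝ) :
    ∃ C : ℝ, ∀ k, frob (iterate Ω X lam k) (iterate Ω X lam k) ≤ C ^ 2 := by
  rcases hlam.eq_or_lt with rfl | hpos
  · refine ⟨nuclearNorm (proj Ω X), fun k => ?_⟩
    cases k with
    | zero => simpa [iterate, frob] using sq_nonneg _
    | succ k => rw [iterate_succ_of_lam_zero]; exact frob_self_le_nuclearNorm_sq _
  · refine ⟨objective Ω X lam (iterate Ω X lam 0) / lam, fun k => (frob_self_le_nuclearNorm_sq _).trans ?_⟩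
    have h : objective Ω X lam (iterate Ω X lam k) ≤ objective Ω X lam (iterate Ω X lam 0) :=
      objective_iterate_antitone hlam Ω X (Nat.zero_le k)
    rw [objective_eq Ω X lam (iterate Ω X lam k)] at h
    have h0 := frob_self_nonneg (proj Ω (iterate Ω X lam k) - proj Ω X)
    refine pow_le_pow_left₀ (nuclearNorm_nonneg _) ?_ 2
    rw [le_div_iff₀ hpos]
    linarith

theorem tendsto_frob_iterate_sub_succ {lam : ℝ} (hlam : 0 ≤ lam) (Ω : Finset (Fin m × Fin n))
    (X : Matrix (Fin m) (Fin n) ℝ) :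
    Tendsto (fun k => frob (iterate Ω X lam k - iterate Ω X lam (k + 1))
      (iterate Ω X lam k - iterate Ω X lam (k + 1))) atTop (𝓝 0) := by
  have hlim := tendsto_atTop_ciInf (objective_iterate_antitone hlam Ω X)
    ⟨0, by rintro _ ⟨k, rfl⟩; exact objective_nonneg hlam Ω X _⟩
  have hd := (hlim.sub ((tendsto_add_atTop_iff_nat 1).2 hlim)).const_mul 2
  rw [sub_self, mul_zero] at hd
  refine squeeze_zero (fun k => frob_self_nonneg _) (fun k => ?_) hd
  have h := objective_step_add_le hlam Ω X (iterate Ω X lam k)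
  rw [← iterate_succ] at h
  linarith

section Convergence

attribute [local instance] Matrix.frobeniusNormedAddCommGroup Matrix.frobeniusNormedSpace

theorem norm_le_iff_frob_le (A B : Matrix (Fin m) (Fin n) ℝ) :
    ‖A‖ ≤ ‖B‖ ↔ frob A A ≤ frob B B := by
  rw [← frobenius_norm_sq, ← frobenius_norm_sq, sq_le_sq₀ (norm_nonneg _) (norm_nonneg _)]

theorem step_lipschitz {lam : ℝ} (hlam : 0 ≤ lam) (Ω : Finset (Fin m × Fin n))
    (X : Matrix (Fin m) (Fin n) ℝ) : LipschitzWith 1 (step Ω X lam) :=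
  LipschitzWith.of_dist_le_mul fun A B => by
    rw [NNReal.coe_one, one_mul, dist_eq_norm, dist_eq_norm, norm_le_iff_frob_le]
    exact step_nonexpansive hlam Ω X A B

theorem exists_tendsto_dist_iterate {lam : ℝ} (hlam : 0 ≤ lam) (Ω : Finset (Fin m × Fin n))
    (X : Matrix (Fin m) (Fin n) ℝ) :
    ∃ Z : Matrix (Fin m) (Fin n) ℝ,
      Tendsto (fun k => dist (iterate Ω X lam k) Z) atTop (𝓝 0) ∧ step Ω X lam Z = Z := by
  have : ProperSpace (Matrix (Fin m) (Fin n) ℝ) := FiniteDimensional.proper ℝ _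
  obtain ⟨C, hC⟩ := exists_frob_iterate_le hlam Ω X
  have hbd : ∀ k, iterate Ω X lam k ∈ Metric.closedBall (0 : Matrix (Fin m) (Fin n) ℝ) |C| := by
    intro k
    rw [mem_closedBall_zero_iff]
    refine abs_le_of_sq_le_sq' ?_ (abs_nonneg C) |>.2
    rw [frobenius_norm_sq, sq_abs]
    exact hC k
  obtain ⟨Z, -, φ, hφ, hZ⟩ := (isCompact_closedBall _ _).tendsto_subseq hbd
  have hstep := ((step_lipschitz hlam Ω X).continuous.tendsto Z).comp hZ
  have hdiff : Tendsto (fun k => dist (iterate Ω X lam k) (iterate Ω X lam (k + 1))) atTop (𝓝 0) := by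
    simp only [dist_eq_norm]
    have h := (tendsto_frob_iterate_sub_succ hlam Ω X).sqrt
    simpa [← frobenius_norm_sq] using h
  have hfix : step Ω X lam Z = Z := by
    -- Applying the step to the iterate `φ k` gives, by definition, the iterate `φ k + 1`, so `dist
    -- Z (step Z)` is a limit of consecutive gaps.
    have h := tendsto_nhds_unique (hZ.dist hstep) (hdiff.comp hφ.tendsto_atTop)
    exact (dist_eq_zero.1 h).symm
  refine ⟨Z, ?_, hfix⟩
  have hanti : Antitone fun k => dist (iterate Ω X lam k) Z := by
    refine antitone_nat_of_succ_le fun k => ?_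
    have h := (step_lipschitz hlam Ω X).dist_le_mul (iterate Ω X lam k) Z
    rwa [hfix, NNReal.coe_one, one_mul] at h
  -- The monotone distances have a limit, and the convergent subsequence forces it to be zero.
  have hlim := tendsto_atTop_ciInf hanti ⟨0, by rintro _ ⟨k, rfl⟩; exact dist_nonneg⟩
  have hsub := hlim.comp hφ.tendsto_atTop
  rwa [tendsto_nhds_unique hsub (tendsto_iff_dist_tendsto_zero.1 hZ)] at hlim

theorem exists_tendsto_iterate {lam : ℝ} (hlam : 0 ≤ lam) (Ω : Finset (Fin m × Fin n))
    (X : Matrix (Fin m) (Fin n) ℝ) :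
    ∃ Z : Matrix (Fin m) (Fin n) ℝ,
      Tendsto (iterate Ω X lam) atTop (𝓝 Z) ∧ step Ω X lam Z = Z := by
  obtain ⟨Z, hZ, hfix⟩ := exists_tendsto_dist_iterate hlam Ω X
  exact ⟨Z, tendsto_iff_dist_tendsto_zero.2 hZ, hfix⟩

end Convergence

end

end SoftImpute

/-- Convergence of Soft-Impute: every iterate is the unique minimizer of the surrogate at the
previous one, and the iterates converge to a minimizer of the nuclear norm regularized problem. -/
theorem mainTheorem1 (m n : ℕ) (Ω : Finset (Fin m × Fin n)) (X : Matrix (Fin m) (Fin n) ℝ)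
    (lam : ℝ) (hlam : 0 ≤ lam) :
    (∀ k : ℕ, ∀ Y : Matrix (Fin m) (Fin n) ℝ, Y ≠ SoftImpute.iterate Ω X lam (k + 1) →
      SoftImpute.surrogate Ω X lam (SoftImpute.iterate Ω X lam k)
          (SoftImpute.iterate Ω X lam (k + 1)) <
        SoftImpute.surrogate Ω X lam (SoftImpute.iterate Ω X lam k) Y) ∧
    ∃ Zlim : Matrix (Fin m) (Fin n) ℝ,
      Filter.Tendsto (SoftImpute.iterate Ω X lam) Filter.atTop (nhds Zlim) ∧
      IsMinOn (SoftImpute.objective Ω X lam) Set.univ Zlim := by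
  refine ⟨fun k Y hY => ?_, ?_⟩
  · have h := SoftImpute.surrogate_step_add_le hlam Ω X (SoftImpute.iterate Ω X lam k) Y
    have hpos := SoftImpute.frob_self_pos (sub_ne_zero.2 hY)
    rw [SoftImpute.iterate_succ] at hpos ⊢
    linarith
  · obtain ⟨Z, hZ, hfix⟩ := SoftImpute.exists_tendsto_iterate hlam Ω X
    exact ⟨Z, hZ, SoftImpute.isMinOn_objective_of_step_eq hlam Ω X hfix⟩
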